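/- For a field $\mathbb{K}\in\{\mathbb{R},\mathbb{C}\}$ and an integer $k\ge 1$, let $\pi_{k,\mathbb{K}}$ be the set of polynomials $p$ with coefficients in $\mathbb{K}$, of degree at most $k$, with $p(0)=1$. For $A\in\mathbb{R}^{n\times n}$ and $\mathbb{K},\mathbb{F}\in\{\mathbb{R},\mathbb{C}\}$ let $$\Psi_{k,\mathbb{K},\mathbb{F}}(A)=\max_{b\in\mathbb{F}^n,\ \|b\|=1}\ \min_{p\in\pi_{k,\mathbb{K}}}\|p(A)b\|,$$ where $\|\cdot\|$ is the Euclidean norm, and let $d(A)$ be the degree of the minimal polynomial of $A$. Theorem. (i) For every $n$, every nonsingular matrix $A\in\mathbb{R}^{n\times n}$ and every integer $k$ with $1\le k\le d(A)-1$, $$\Psi_{k,\mathbb{R},\mathbb{R}}(A)=\Psi_{k,\mathbb{C},\mathbb{R}}(A)\le\Psi_{k,\mathbb{C},\mathbb{C}}(A)\le\Psi_{k,\mathbb{R},\mathbb{C}}(A).$$ (ii) Both inequalities can be strict: there exist $n$, a nonsingular $A\in\mathbb{R}^{n\times n}$ and $1\le k\le d(A)-1$ with $\Psi_{k,\mathbb{C},\mathbb{R}}(A)<\Psi_{k,\mathbb{C},\mathbb{C}}(A)$;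 and there exist (possibly different) $n$, a nonsingular $A\in\mathbb{R}^{n\times n}$ and $1\le k\le d(A)-1$ with $\Psi_{k,\mathbb{C},\mathbb{C}}(A)<\Psi_{k,\mathbb{R},\mathbb{C}}(A)$. -/

import Mathlib

open Polynomial

/-- The set `π_{k,K}` of polynomials over `K` of degree at most `k` with value one at the origin. -/
def residualPolynomials (K : Type) [Field K] (k : ℕ) : Set K[X] :=
  {p | p.natDegree ≤ k ∧ p.eval 0 = 1}

/-- The vector `p(A) b ∈ ℂⁿ`, for a real square matrix `A`, a polynomial `p` over `K` and a
vector `b` over `F`. Here `K` and `F` stand for `ℝ` or `ℂ`, with their usual maps to `ℂ`. -/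
noncomputable def polyVec {n : ℕ} {K F : Type} [RCLike K] [NormedAlgebra K ℂ]
    [RCLike F] [NormedAlgebra F ℂ] (A : Matrix (Fin n) (Fin n) ℝ) (p : K[X])
    (b : EuclideanSpace F (Fin n)) : EuclideanSpace ℂ (Fin n) :=
  WithLp.toLp 2 ((aeval (A.map (algebraMap ℝ ℂ)) p).mulVec fun i => algebraMap F ℂ (b i))

/-- The GMRES residual norm `min_{p ∈ π_{k,K}} ‖p(A) b‖` (Euclidean norm). -/
noncomputable def gmresResidual (k : ℕ) (K : Type) {F : Type} [RCLike K] [NormedAlgebra K ℂ]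
    [RCLike F] [NormedAlgebra F ℂ] {n : ℕ} (A : Matrix (Fin n) (Fin n) ℝ)
    (b : EuclideanSpace F (Fin n)) : ℝ :=
  ⨅ p : residualPolynomials K k, ‖polyVec A (p : K[X]) b‖

/-- The worst-case GMRES approximation
`Ψ_{k,K,F}(A) = max_{b ∈ Fⁿ, ‖b‖ = 1} min_{p ∈ π_{k,K}} ‖p(A) b‖`.
Both extrema are attained, see `isLeast_gmresResidual` and `isGreatest_worstCaseGMRES`. -/
noncomputable def worstCaseGMRES (k : ℕ) (K F : Type) [RCLike K] [NormedAlgebra K ℂ]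
    [RCLike F] [NormedAlgebra F ℂ] {n : ℕ} (A : Matrix (Fin n) (Fin n) ℝ) : ℝ :=
  ⨆ b : Metric.sphere (0 : EuclideanSpace F (Fin n)) 1,
    gmresResidual k K A (b : EuclideanSpace F (Fin n))

theorem one_mem_residualPolynomials {K : Type} [Field K] (k : ℕ) : (1 : K[X]) ∈ residualPolynomials K k := by
  simp [residualPolynomials]

section Attainment

variable {K F : Type} [RCLike K] [NormedAlgebra K ℂ] [RCLike F] [NormedAlgebra F ℂ] {n : ℕ}

/-- The minimum in the definition of the GMRES residual norm is attained. -/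
theorem isLeast_gmresResidual (k : ℕ) (A : Matrix (Fin n) (Fin n) ℝ)
    (b : EuclideanSpace F (Fin n)) :
    IsLeast ((fun p : K[X] => ‖polyVec A p b‖) '' residualPolynomials K k)
      (gmresResidual k K A b) := by
  have hbdd : BddBelow (Set.range fun p : residualPolynomials K k =>
      ‖polyVec A (p : K[X]) b‖) := ⟨0, by rintro _ ⟨p, rfl⟩; exact norm_nonneg _⟩
  have : Nonempty (residualPolynomials K k) := ⟨⟨1, one_mem_residualPolynomials k⟩⟩
  let L : K[X] →ₗ[K] EuclideanSpace ℂ (Fin n) :=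
    { toFun := fun p => polyVec A p b
      map_add' := fun p q => by
        ext i; simp [polyVec, Matrix.add_mulVec]
      map_smul' := fun c p => by
        ext i; simp [polyVec, Matrix.smul_mulVec] }
  let V : Submodule K K[X] := degreeLE K (k : WithBot ℕ) ⊓ LinearMap.ker (lcoeff K 0)
  have : Module.Finite K V := by
    have : Module.Finite K (degreeLT K (k + 1)) :=
      Module.Finite.equiv (degreeLTEquiv K (k + 1)).symm
    have hle : V ≤ degreeLT K (k + 1) := by
      intro p hp
      have h1 := mem_degreeLE.1 hp.1
      rw [mem_degreeLT]
      exact lt_of_le_of_lt h1 (by exact_mod_cast Nat.lt_succ_self k)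
    exact Module.Finite.of_injective (Submodule.inclusion hle) (Submodule.inclusion_injective hle)
  have hcl : IsClosed ((V.map L : Submodule K (EuclideanSpace ℂ (Fin n))) :
      Set (EuclideanSpace ℂ (Fin n))) := Submodule.closed_of_finiteDimensional _
  obtain ⟨y, ⟨q, hq, rfl⟩, hy⟩ := hcl.exists_infDist_eq_dist ⟨0, Submodule.zero_mem _⟩
    (-(L 1))
  have hmem : ∀ p : K[X], p ∈ residualPolynomials K k ↔ p - 1 ∈ V := by
    intro p
    have hV : p - 1 ∈ V ↔ p - 1 ∈ degreeLE K (k : WithBot ℕ) ∧ (p - 1).coeff 0 = 0 := by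
      simp [V, Submodule.mem_inf]
    rw [hV, mem_degreeLE, ← natDegree_le_iff_degree_le, coeff_sub, coeff_one_zero, sub_eq_zero,
      coeff_zero_eq_eval_zero]
    constructor
    · rintro ⟨h1, h2⟩
      exact ⟨(natDegree_sub_le _ _).trans (by simpa using h1), h2⟩
    · rintro ⟨h1, h2⟩
      refine ⟨?_, h2⟩
      have := natDegree_add_le (p - 1) 1
      simpa using this.trans (by simpa using h1)
  have hq' : q + 1 ∈ residualPolynomials K k := (hmem _).2 (by simpa using hq)
  have hmin : ∀ p ∈ residualPolynomials K k, ‖polyVec A (q + 1) b‖ ≤ ‖polyVec A p b‖ := by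
    intro p hp
    have h := Metric.infDist_le_dist_of_mem (x := -(L 1))
      (Submodule.mem_map_of_mem (f := L) ((hmem p).1 hp))
    rw [SetLike.mem_coe] at *
    have e : ∀ r : K[X], dist (-(L 1)) (L r) = ‖polyVec A (r + 1) b‖ := by
      intro r
      rw [dist_comm, dist_eq_norm, sub_neg_eq_add, ← map_add]
      rfl
    have h' := hy.symm.le.trans h
    rwa [e, e, sub_add_cancel] at h'
  have heq : gmresResidual k K A b = ‖polyVec A (q + 1) b‖ :=
    le_antisymm (ciInf_le hbdd ⟨q + 1, hq'⟩) (le_ciInf fun p => hmin p p.2)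
  rw [heq]
  exact ⟨⟨q + 1, hq', rfl⟩, by rintro _ ⟨p, hp, rfl⟩; exact hmin p hp⟩

/-- The maximum in the definition of the worst-case GMRES approximation is attained. -/
theorem isGreatest_worstCaseGMRES (k : ℕ) (A : Matrix (Fin n) (Fin n) ℝ) (hn : n ≠ 0) :
    IsGreatest ((fun b : EuclideanSpace F (Fin n) => gmresResidual k K A b) '' {b | ‖b‖ = 1})
      (worstCaseGMRES k K F A) := by
  have : NeZero n := ⟨hn⟩
  have hcont : ∀ p : K[X], Continuous fun b : EuclideanSpace F (Fin n) => ‖polyVec A p b‖ := by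
    intro p
    have h : ∀ i : Fin n, Continuous fun b : EuclideanSpace F (Fin n) =>
        algebraMap F ℂ (b i) := fun i =>
      (algebraMapCLM F ℂ).continuous.comp (EuclideanSpace.proj i).continuous
    refine Continuous.norm ?_
    exact (PiLp.continuous_toLp 2 _).comp (continuous_const.matrix_mulVec (continuous_pi h))
  have husc : UpperSemicontinuousOn (fun b : EuclideanSpace F (Fin n) => gmresResidual k K A b)
      (Metric.sphere 0 1) := by
    intro b _ y hy
    obtain ⟨p, hp, hpy⟩ := (isLeast_gmresResidual (K := K) k A b).1
    have hpy' : ‖polyVec A p b‖ < y := by simpa [← hpy] using hy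
    filter_upwards [mem_nhdsWithin_of_mem_nhds ((hcont p).continuousAt.eventually_lt_const hpy')]
      with c hc
    exact ((isLeast_gmresResidual (K := K) k A c).2 ⟨p, hp, rfl⟩).trans_lt hc
  have hne : (Metric.sphere (0 : EuclideanSpace F (Fin n)) 1).Nonempty :=
    ⟨EuclideanSpace.single 0 1, by simp⟩
  obtain ⟨b, hb, hmax⟩ := husc.exists_isMaxOn hne (isCompact_sphere _ _)
  have : Nonempty (Metric.sphere (0 : EuclideanSpace F (Fin n)) 1) := hne.to_subtype
  have heq : worstCaseGMRES k K F A = gmresResidual k K A b :=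
    le_antisymm (ciSup_le fun c => hmax c.2)
      (le_ciSup (f := fun c : Metric.sphere (0 : EuclideanSpace F (Fin n)) 1 =>
        gmresResidual k K A (c : EuclideanSpace F (Fin n)))
        ⟨gmresResidual k K A b, by rintro _ ⟨c, rfl⟩; exact hmax c.2⟩ ⟨b, hb⟩)
  rw [heq]
  exact ⟨⟨b, by simpa using hb, rfl⟩, by rintro _ ⟨c, hc, rfl⟩; exact hmax (by simpa using hc)⟩

end Attainment

/-! ### Order bounds for the two extrema, and coefficient expansion -/

section Residuals

variable {K F : Type} [RCLike K] [NormedAlgebra K ℂ] [RCLike F] [NormedAlgebra F ℂ] {n : ℕ}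

/-! For real `A` and `b`, replacing the coefficients of `p` by their real parts replaces `p(A)b` by
its entrywise real part, which is no longer; hence the equality in (i). The inequalities only
enlarge the set of vectors or shrink the set of polynomials.

For (ii), `p = 1` bounds every residual of a unit vector by one, so strictness can be read off from
stagnation. If `b* A^j b = 0` for `1 ≤ j ≤ k`, the residual is one (`one_le_gmresResidual`); for
real polynomials `Re (b* A^j b) = 0` already suffices. If no nonzero `b` satisfies all the complex
equations, attainment of the maximum gives a value below one (`worstCaseGMRES_lt_one`). Two explicit
4×4 matrices with `k = 3` separate these conditions. -/

theorem bddBelow_norm_polyVec (k : ℕ) (A : Matrix (Fin n) (Fin n) ℝ)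
    (b : EuclideanSpace F (Fin n)) :
    BddBelow (Set.range fun p : residualPolynomials K k => ‖polyVec A (p : K[X]) b‖) :=
  ⟨0, by rintro _ ⟨p, rfl⟩; exact norm_nonneg _⟩

theorem gmresResidual_le {k : ℕ} (A : Matrix (Fin n) (Fin n) ℝ)
    (b : EuclideanSpace F (Fin n)) {p : K[X]} (hp : p ∈ residualPolynomials K k) :
    gmresResidual k K A b ≤ ‖polyVec A p b‖ :=
  ciInf_le (bddBelow_norm_polyVec k A b) ⟨p, hp⟩

theorem le_gmresResidual {k : ℕ} {A : Matrix (Fin n) (Fin n) ℝ}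
    {b : EuclideanSpace F (Fin n)} {r : ℝ}
    (h : ∀ p ∈ residualPolynomials K k, r ≤ ‖polyVec A p b‖) :
    r ≤ gmresResidual k K A b := by
  have : Nonempty (residualPolynomials K k) := ⟨⟨1, one_mem_residualPolynomials k⟩⟩
  exact le_ciInf fun p => h p p.2

theorem bddAbove_gmresResidual (k : ℕ) (A : Matrix (Fin n) (Fin n) ℝ) :
    BddAbove (Set.range fun b : Metric.sphere (0 : EuclideanSpace F (Fin n)) 1 =>
      gmresResidual k K A (b : EuclideanSpace F (Fin n))) := by
  rcases eq_or_ne n 0 with rfl | hn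
  -- In dimension zero the unit sphere is empty.
  · refine ⟨0, ?_⟩
    rintro _ ⟨b, rfl⟩
    have hb : ‖(b : EuclideanSpace F (Fin 0))‖ = 1 := by simp
    simp [Subsingleton.elim (b : EuclideanSpace F (Fin 0)) 0] at hb
  · refine ⟨worstCaseGMRES k K F A, ?_⟩
    rintro _ ⟨b, rfl⟩
    exact (isGreatest_worstCaseGMRES k A hn).2 ⟨b, by simp, rfl⟩

theorem gmresResidual_le_worstCaseGMRES (k : ℕ) (A : Matrix (Fin n) (Fin n) ℝ)
    {b : EuclideanSpace F (Fin n)} (hb : ‖b‖ = 1) :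
    gmresResidual k K A b ≤ worstCaseGMRES k K F A :=
  le_ciSup (bddAbove_gmresResidual (K := K) k A)
    (⟨b, by simpa using hb⟩ : Metric.sphere (0 : EuclideanSpace F (Fin n)) 1)

theorem gmresResidual_nonneg (k : ℕ) (A : Matrix (Fin n) (Fin n) ℝ)
    (b : EuclideanSpace F (Fin n)) : 0 ≤ gmresResidual k K A b :=
  le_gmresResidual fun _ _ => norm_nonneg _

theorem worstCaseGMRES_nonneg (k : ℕ) (A : Matrix (Fin n) (Fin n) ℝ) :
    0 ≤ worstCaseGMRES k K F A :=
  Real.iSup_nonneg fun _ => gmresResidual_nonneg k A _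

/-- The condition `0 ≤ r` covers `n = 0`, where the supremum over the empty sphere is `0`. -/
theorem worstCaseGMRES_le {k : ℕ} {A : Matrix (Fin n) (Fin n) ℝ} {r : ℝ} (hr : 0 ≤ r)
    (h : ∀ b : EuclideanSpace F (Fin n), ‖b‖ = 1 → gmresResidual k K A b ≤ r) :
    worstCaseGMRES k K F A ≤ r :=
  Real.iSup_le (fun b => h b (by simp)) hr

/-- The bound `k` is free so that polynomials of different degrees can be expanded over one range.
-/
theorem polyVec_eq_sum {k : ℕ} (A : Matrix (Fin n) (Fin n) ℝ) {p : K[X]} (hp : p.natDegree ≤ k)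
    (b : EuclideanSpace F (Fin n)) (i : Fin n) :
    polyVec A p b i = ∑ j ∈ Finset.range (k + 1), algebraMap K ℂ (p.coeff j) *
      ∑ l, ((A ^ j) i l : ℂ) * algebraMap F ℂ (b l) := by
  have hpow : ∀ j, (A.map (algebraMap ℝ ℂ)) ^ j = (A ^ j).map (algebraMap ℝ ℂ) := fun j => by
    rw [← RingHom.mapMatrix_apply, ← RingHom.mapMatrix_apply, map_pow]
  rw [polyVec, aeval_eq_sum_range' (Nat.lt_succ_of_le hp)]
  simp only [Matrix.mulVec, dotProduct, Matrix.sum_apply, Matrix.smul_apply, hpow,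
    Matrix.map_apply, Finset.sum_mul, Finset.mul_sum]
  rw [Finset.sum_comm]
  simp only [Algebra.smul_def, mul_assoc, Complex.coe_algebraMap]

end Residuals

/-! ### Part (i): comparing real and complex data -/

section FieldComparison

variable {n : ℕ}

theorem polyVec_map_ofReal {F : Type} [RCLike F] [NormedAlgebra F ℂ]
    (A : Matrix (Fin n) (Fin n) ℝ) (p : ℝ[X]) (b : EuclideanSpace F (Fin n)) :
    polyVec A (p.map (algebraMap ℝ ℂ)) b = polyVec A p b := by
  ext i
  rw [polyVec_eq_sum A (natDegree_map_le (f := algebraMap ℝ ℂ)) b, polyVec_eq_sum A le_rfl b]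
  simp

theorem map_mem_residualPolynomials {k : ℕ} {p : ℝ[X]} (hp : p ∈ residualPolynomials ℝ k) :
    p.map (algebraMap ℝ ℂ) ∈ residualPolynomials ℂ k := by
  refine ⟨natDegree_map_le.trans hp.1, ?_⟩
  have h0 := hp.2
  rw [← coeff_zero_eq_eval_zero] at h0 ⊢
  rw [coeff_map, h0, map_one]

theorem gmresResidual_complex_le_real {F : Type} [RCLike F] [NormedAlgebra F ℂ] (k : ℕ)
    (A : Matrix (Fin n) (Fin n) ℝ) (b : EuclideanSpace F (Fin n)) :
    gmresResidual k ℂ A b ≤ gmresResidual k ℝ A b :=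
  le_gmresResidual fun p hp => by
    rw [← polyVec_map_ofReal]
    exact gmresResidual_le A b (map_mem_residualPolynomials hp)

/-- The polynomial of real parts of the coefficients. -/
noncomputable def rePolynomial (p : ℂ[X]) : ℝ[X] :=
  ∑ j ∈ Finset.range (p.natDegree + 1), monomial j (p.coeff j).re

theorem coeff_rePolynomial (p : ℂ[X]) (j : ℕ) : (rePolynomial p).coeff j = (p.coeff j).re := by
  simp only [rePolynomial, finsetSum_coeff, coeff_monomial, Finset.sum_ite_eq', Finset.mem_range]
  split_ifs with h
  · rfl
  · rw [coeff_eq_zero_of_natDegree_lt (by omega), Complex.zero_re]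

theorem natDegree_rePolynomial_le (p : ℂ[X]) : (rePolynomial p).natDegree ≤ p.natDegree :=
  natDegree_le_iff_coeff_eq_zero.2 fun j hj => by
    rw [coeff_rePolynomial, coeff_eq_zero_of_natDegree_lt hj, Complex.zero_re]

theorem rePolynomial_mem_residualPolynomials {k : ℕ} {p : ℂ[X]}
    (hp : p ∈ residualPolynomials ℂ k) : rePolynomial p ∈ residualPolynomials ℝ k := by
  refine ⟨(natDegree_rePolynomial_le p).trans hp.1, ?_⟩
  have h0 := hp.2
  rw [← coeff_zero_eq_eval_zero] at h0 ⊢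
  rw [coeff_rePolynomial, h0, Complex.one_re]

/-- The coefficients multiply the real vectors `A^j b`, so taking real parts commutes with the sum.
-/
theorem polyVec_rePolynomial (A : Matrix (Fin n) (Fin n) ℝ) (p : ℂ[X])
    (b : EuclideanSpace ℝ (Fin n)) (i : Fin n) :
    polyVec A (rePolynomial p) b i = ((polyVec A p b i).re : ℂ) := by
  rw [polyVec_eq_sum A (natDegree_rePolynomial_le p) b, polyVec_eq_sum A le_rfl b]
  simp only [coeff_rePolynomial, Complex.coe_algebraMap, Algebra.algebraMap_self, RingHom.id_apply]
  simp only [← Complex.ofReal_mul, ← Complex.ofReal_sum, Complex.re_sum, Complex.re_mul_ofReal]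

theorem gmresResidual_real_eq_complex (k : ℕ) (A : Matrix (Fin n) (Fin n) ℝ)
    (b : EuclideanSpace ℝ (Fin n)) : gmresResidual k ℝ A b = gmresResidual k ℂ A b := by
  refine le_antisymm (le_gmresResidual fun p hp => ?_) (gmresResidual_complex_le_real k A b)
  refine (gmresResidual_le A b (rePolynomial_mem_residualPolynomials hp)).trans ?_
  rw [EuclideanSpace.norm_eq, EuclideanSpace.norm_eq]
  gcongr with i
  rw [polyVec_rePolynomial, Complex.norm_real]
  exact Complex.abs_re_le_norm _

theorem worstCaseGMRES_real_real_eq (k : ℕ) (A : Matrix (Fin n) (Fin n) ℝ) :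
    worstCaseGMRES k ℝ ℝ A = worstCaseGMRES k ℂ ℝ A := by
  simp only [worstCaseGMRES, gmresResidual_real_eq_complex]

theorem worstCaseGMRES_complex_real_le (k : ℕ) (A : Matrix (Fin n) (Fin n) ℝ) :
    worstCaseGMRES k ℂ ℝ A ≤ worstCaseGMRES k ℂ ℂ A := by
  refine worstCaseGMRES_le (worstCaseGMRES_nonneg k A) fun b hb => ?_
  have hb' : ‖(WithLp.toLp 2 fun i => (b i : ℂ) : EuclideanSpace ℂ (Fin n))‖ = 1 := by
    rw [← hb, EuclideanSpace.norm_eq, EuclideanSpace.norm_eq]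
    simp
  exact gmresResidual_le_worstCaseGMRES (K := ℂ) k A hb'

theorem worstCaseGMRES_complex_complex_le (k : ℕ) (A : Matrix (Fin n) (Fin n) ℝ) :
    worstCaseGMRES k ℂ ℂ A ≤ worstCaseGMRES k ℝ ℂ A :=
  worstCaseGMRES_le (worstCaseGMRES_nonneg k A) fun _ hb =>
    (gmresResidual_complex_le_real k A _).trans (gmresResidual_le_worstCaseGMRES k A hb)

end FieldComparison

/-! ### Stagnation and the forms `b* A^j b` -/

section Stagnation

variable {K F : Type} [RCLike K] [NormedAlgebra K ℂ] [RCLike F] [NormedAlgebra F ℂ] {n : ℕ}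

/-- The quadratic form `b* A ^ j b`. -/
noncomputable def krylovForm (A : Matrix (Fin n) (Fin n) ℝ) (j : ℕ)
    (b : EuclideanSpace F (Fin n)) : ℂ :=
  ∑ i, (∑ l, ((A ^ j) i l : ℂ) * algebraMap F ℂ (b l)) * star (algebraMap F ℂ (b i))

theorem polyVec_one_apply (A : Matrix (Fin n) (Fin n) ℝ) (b : EuclideanSpace F (Fin n))
    (i : Fin n) : polyVec A (1 : K[X]) b i = algebraMap F ℂ (b i) := by
  simp [polyVec]

theorem norm_polyVec_one (A : Matrix (Fin n) (Fin n) ℝ) (b : EuclideanSpace F (Fin n)) :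
    ‖polyVec A (1 : K[X]) b‖ = ‖b‖ := by
  rw [EuclideanSpace.norm_eq, EuclideanSpace.norm_eq]
  simp only [polyVec_one_apply, norm_algebraMap']

theorem inner_polyVec {k : ℕ} (A : Matrix (Fin n) (Fin n) ℝ) {p : K[X]} (hp : p.natDegree ≤ k)
    (b : EuclideanSpace F (Fin n)) :
    inner ℂ (polyVec A (1 : K[X]) b) (polyVec A p b) =
      ∑ j ∈ Finset.range (k + 1), algebraMap K ℂ (p.coeff j) * krylovForm A j b := by
  simp only [PiLp.inner_apply, polyVec_eq_sum A hp b, polyVec_one_apply, RCLike.inner_apply,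
    krylovForm, Finset.mul_sum, Finset.sum_mul, starRingEnd_apply]
  rw [Finset.sum_comm]
  simp only [mul_assoc]

theorem krylovForm_zero (A : Matrix (Fin n) (Fin n) ℝ) (b : EuclideanSpace F (Fin n)) :
    krylovForm A 0 b = (‖b‖ : ℂ) ^ 2 := by
  have h := inner_polyVec (k := 0) A (p := (1 : ℂ[X])) (by simp) b
  rw [inner_self_eq_norm_sq_to_K, norm_polyVec_one] at h
  simpa using h.symm

/-- Since `p(0) = 1`, the inner product of `b` with `p(A)b` has real part one; Cauchy–Schwarz
concludes. For `K = ℝ` the hypothesis concerns only the real part of the form. -/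
theorem one_le_gmresResidual {k : ℕ} {A : Matrix (Fin n) (Fin n) ℝ}
    {b : EuclideanSpace F (Fin n)} (hb : ‖b‖ = 1)
    (h : ∀ c : K, ∀ j, 1 ≤ j → j ≤ k → (algebraMap K ℂ c * krylovForm A j b).re = 0) :
    1 ≤ gmresResidual k K A b := by
  refine le_gmresResidual fun p hp => ?_
  have h1 : (inner ℂ (polyVec A (1 : K[X]) b) (polyVec A p b)).re = 1 := by
    rw [inner_polyVec A hp.1, Finset.sum_range_succ', Complex.add_re, Complex.re_sum,
      Finset.sum_eq_zero fun j hj => h _ _ (by omega)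
        (by have := Finset.mem_range.1 hj; omega), krylovForm_zero, hb,
      coeff_zero_eq_eval_zero, hp.2]
    simp
  have h2 := (Complex.re_le_norm _).trans
    (norm_inner_le_norm (𝕜 := ℂ) (polyVec A (1 : K[X]) b) (polyVec A p b))
  rwa [h1, norm_polyVec_one, hb, one_mul] at h2

/-- Subtract from `u` its projection onto `w` and apply Pythagoras. -/
theorem exists_norm_add_smul_lt {E : Type*} [NormedAddCommGroup E] [InnerProductSpace ℂ E]
    {u w : E} (h : inner ℂ u w ≠ 0) : ∃ c : ℂ, ‖u + c • w‖ < ‖u‖ := by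
  have hw : w ≠ 0 := by rintro rfl; simp at h
  have hw' : inner ℂ w w ≠ 0 := inner_self_ne_zero.2 hw
  have h' : inner ℂ w u ≠ 0 := by rwa [Ne, inner_eq_zero_symm]
  set c : ℂ := inner ℂ w u / inner ℂ w w with hc
  refine ⟨-c, ?_⟩
  have horth : inner ℂ (c • w) (u + -c • w) = 0 := by
    rw [inner_smul_left, inner_add_right, inner_smul_right, hc]
    field_simp
    ring
  have hpyth := norm_add_sq_eq_norm_sq_add_norm_sq_of_inner_eq_zero _ _ horth
  have hu : c • w + (u + -c • w) = u := by rw [neg_smul]; abel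
  rw [hu] at hpyth
  have hpos : 0 < ‖c • w‖ := norm_pos_iff.2 (smul_ne_zero (div_ne_zero h' hw') hw)
  nlinarith [norm_nonneg u, norm_nonneg (u + -c • w)]

/-- One nonvanishing form is enough: `1 + c X^j` already reduces the norm. -/
theorem gmresResidual_lt_norm {k j : ℕ} {A : Matrix (Fin n) (Fin n) ℝ}
    {b : EuclideanSpace F (Fin n)} (hj : 1 ≤ j) (hjk : j ≤ k) (h : krylovForm A j b ≠ 0) :
    gmresResidual k ℂ A b < ‖b‖ := by
  have hinner : inner ℂ (polyVec A (1 : ℂ[X]) b) (polyVec A (X ^ j : ℂ[X]) b) ≠ 0 := by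
    rw [inner_polyVec (k := j) A (by simp)]
    simpa [coeff_X_pow] using h
  obtain ⟨c, hc⟩ := exists_norm_add_smul_lt hinner
  have hp : 1 + c • (X ^ j : ℂ[X]) ∈ residualPolynomials ℂ k := by
    refine ⟨(natDegree_add_le _ _).trans (max_le (by simp) ?_), ?_⟩
    · exact (natDegree_smul_le _ _).trans (by simpa using hjk)
    · simp [show j ≠ 0 by omega]
  have heq : polyVec A (1 + c • (X ^ j : ℂ[X])) b =
      polyVec A (1 : ℂ[X]) b + c • polyVec A (X ^ j : ℂ[X]) b := by
    ext i
    simp [polyVec, Matrix.add_mulVec, Matrix.smul_mulVec]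
  rw [norm_polyVec_one] at hc
  exact (gmresResidual_le A b hp).trans_lt (heq ▸ hc)

theorem worstCaseGMRES_lt_one {k : ℕ} {A : Matrix (Fin n) (Fin n) ℝ} (hn : n ≠ 0)
    (h : ∀ b : EuclideanSpace F (Fin n), (∀ j, 1 ≤ j → j ≤ k → krylovForm A j b = 0) → b = 0) :
    worstCaseGMRES k ℂ F A < 1 := by
  obtain ⟨b, hb, hmax⟩ := (isGreatest_worstCaseGMRES (K := ℂ) (F := F) k A hn).1
  rw [← hmax]
  have hb1 : ‖b‖ = 1 := hb
  have hb0 : b ≠ 0 := by rintro rfl; simp at hb1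
  have hex : ∃ j, 1 ≤ j ∧ j ≤ k ∧ krylovForm A j b ≠ 0 := by
    by_contra! hcon
    exact hb0 (h b hcon)
  obtain ⟨j, hj, hjk, hne⟩ := hex
  exact hb1 ▸ gmresResidual_lt_norm hj hjk hne

end Stagnation

/-! ### Part (ii): two 4×4 examples -/

section Examples

theorem three_le_natDegree_minpoly_sub_one {n : ℕ} {A : Matrix (Fin n) (Fin n) ℝ}
    (h : ∀ c : Fin 4 → ℝ, c 0 • (1 : Matrix (Fin n) (Fin n) ℝ) + c 1 • A + c 2 • A ^ 2 +
      c 3 • A ^ 3 = 0 → ∀ i, c i = 0) : 3 ≤ (minpoly ℝ A).natDegree - 1 := by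
  by_contra! hlt
  have hdeg : (minpoly ℝ A).natDegree < 4 := by omega
  have h0 := minpoly.aeval ℝ A
  rw [aeval_eq_sum_range' hdeg] at h0
  have hc := h (fun i => (minpoly ℝ A).coeff i) (by simpa [Finset.sum_range_succ] using h0)
  have hmonic := minpoly.monic (Matrix.isIntegral (R := ℝ) A)
  have := hc ⟨_, hdeg⟩
  simp [hmonic.coeff_natDegree] at this

/-- A matrix for which `(1, i, 0, 0)` stagnates during three GMRES steps, but no real vector
does. -/
def complexStagnationMatrix : Matrix (Fin 4) (Fin 4) ℝ :=
  !![1, 0, 1, 0; 0, -1, 0, 1; -1, 0, 0, 2; 0, -1, 2, 0]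

theorem complexStagnationMatrix_sq : complexStagnationMatrix ^ 2 =
    !![0, 0, 1, 2; 0, 0, 2, -1; -1, -2, 3, 0; -2, 1, 0, 3] := by
  rw [pow_two, complexStagnationMatrix]
  ext i j
  fin_cases i <;> fin_cases j <;> simp [Matrix.mul_apply, Fin.sum_univ_four] <;> norm_num

theorem complexStagnationMatrix_cube : complexStagnationMatrix ^ 3 =
    !![-1, -2, 4, 2; -2, 1, -2, 4; -4, 2, -1, 4; -2, -4, 4, 1] := by
  rw [pow_succ, complexStagnationMatrix_sq, complexStagnationMatrix]
  ext i j
  fin_cases i <;> fin_cases j <;> simp [Matrix.mul_apply, Fin.sum_univ_four] <;> norm_num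

/-- A matrix for which `(1, i, 0, 0)` stagnates during three GMRES steps with real polynomials,
but no complex vector stagnates with complex polynomials. -/
def realStagnationMatrix : Matrix (Fin 4) (Fin 4) ℝ :=
  !![5, 3, 4, 0; -3, -5, 0, 4; -4, 0, 0, 3; 0, -4, 9, 0]

theorem realStagnationMatrix_sq : realStagnationMatrix ^ 2 =
    !![0, 0, 20, 24; 0, 0, 24, -20; -20, -24, 11, 0; -24, 20, 0, 11] := by
  rw [pow_two, realStagnationMatrix]
  ext i j
  fin_cases i <;> fin_cases j <;> simp [Matrix.mul_apply, Fin.sum_univ_four] <;> norm_num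

theorem realStagnationMatrix_cube : realStagnationMatrix ^ 3 =
    !![-80, -96, 216, 60; -96, 80, -180, 72; -72, 60, -80, -63; -180, -216, 3, 80] := by
  rw [pow_succ, realStagnationMatrix_sq, realStagnationMatrix]
  ext i j
  fin_cases i <;> fin_cases j <;> simp [Matrix.mul_apply, Fin.sum_univ_four] <;> norm_num

theorem det_complexStagnationMatrix_ne_zero : complexStagnationMatrix.det ≠ 0 := by
  simp [complexStagnationMatrix, Matrix.det_succ_row_zero, Fin.sum_univ_succ,
    show Fin.succAbove (1 : Fin 4) 2 = 3 from rfl, show Fin.succAbove (2 : Fin 4) 2 = 3 from rfl]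
  norm_num

theorem det_realStagnationMatrix_ne_zero : realStagnationMatrix.det ≠ 0 := by
  simp [realStagnationMatrix, Matrix.det_succ_row_zero, Fin.sum_univ_succ,
    show Fin.succAbove (1 : Fin 4) 2 = 3 from rfl, show Fin.succAbove (2 : Fin 4) 2 = 3 from rfl]
  norm_num

theorem three_le_natDegree_minpoly_complexStagnationMatrix :
    3 ≤ (minpoly ℝ complexStagnationMatrix).natDegree - 1 := by
  refine three_le_natDegree_minpoly_sub_one fun c hc => ?_
  rw [complexStagnationMatrix_sq, complexStagnationMatrix_cube] at hc
  -- The first columns of `1, A, A², A³` are already linearly independent.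
  have h0 := congrFun (congrFun hc 0) 0
  have h1 := congrFun (congrFun hc 1) 0
  have h2 := congrFun (congrFun hc 2) 0
  have h3 := congrFun (congrFun hc 3) 0
  simp [complexStagnationMatrix] at h0 h1 h2 h3
  intro i
  fin_cases i <;> simp <;> linarith

theorem three_le_natDegree_minpoly_realStagnationMatrix :
    3 ≤ (minpoly ℝ realStagnationMatrix).natDegree - 1 := by
  refine three_le_natDegree_minpoly_sub_one fun c hc => ?_
  rw [realStagnationMatrix_sq, realStagnationMatrix_cube] at hc
  have h0 := congrFun (congrFun hc 0) 0
  have h1 := congrFun (congrFun hc 1) 0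
  have h2 := congrFun (congrFun hc 2) 0
  have h3 := congrFun (congrFun hc 3) 0
  simp [realStagnationMatrix] at h0 h1 h2 h3
  intro i
  fin_cases i <;> simp <;> linarith

theorem worstCaseGMRES_real_complexStagnationMatrix_lt_one :
    worstCaseGMRES 3 ℂ ℝ complexStagnationMatrix < 1 := by
  refine worstCaseGMRES_lt_one (by norm_num) fun b h => ?_
  have h1 := congrArg Complex.re (h 1 (by norm_num) (by norm_num))
  have h2 := congrArg Complex.re (h 2 (by norm_num) (by norm_num))
  have h3 := congrArg Complex.re (h 3 (by norm_num) (by norm_num))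
  rw [krylovForm, complexStagnationMatrix_sq] at h2
  rw [krylovForm, complexStagnationMatrix_cube] at h3
  simp [krylovForm, complexStagnationMatrix, Fin.sum_univ_four] at h1 h2 h3
  -- The form of `A²` is `3 (b₂² + b₃²)` on real vectors.
  have e2 : b 2 = 0 := by nlinarith [sq_nonneg (b 2), sq_nonneg (b 3)]
  have e3 : b 3 = 0 := by nlinarith [sq_nonneg (b 2), sq_nonneg (b 3)]
  rw [e2, e3] at h1 h3
  -- What remains is `b₀² = b₁²` from `A` and, combined with it, `b₀ b₁ = 0` from `A³`.
  have e01 : b 0 * b 1 = 0 := by linarith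
  have e0 : b 0 = 0 := by
    rcases mul_eq_zero.1 e01 with e | e
    · exact e
    · simpa [e] using h1
  have e1 : b 1 = 0 := by simpa [e0] using h1
  ext i
  fin_cases i <;> simp [e0, e1, e2, e3]

theorem eq_zero_of_sq_add_sq_eq_zero {x y : ℝ} (h : x ^ 2 + y ^ 2 = 0) : x = 0 ∧ y = 0 := by
  simpa using (add_eq_zero_iff_of_nonneg (sq_nonneg x) (sq_nonneg y)).1 h

/-- Plane vectors of equal length that are both orthogonal and parallel vanish. -/
theorem eq_zero_of_orthogonal_of_parallel {x y u v : ℝ} (hnorm : x ^ 2 + y ^ 2 = u ^ 2 + v ^ 2)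
    (hpar : x * v - y * u = 0) (horth : x * u + y * v = 0) :
    (x = 0 ∧ y = 0) ∧ (u = 0 ∧ v = 0) := by
  -- Lagrange's identity for `(x² + y²)(u² + v²)`.
  have hsq : (x ^ 2 + y ^ 2) ^ 2 = 0 := by
    linear_combination (x ^ 2 + y ^ 2) * hnorm + (x * v - y * u) * hpar + (x * u + y * v) * horth
  have hzero : x ^ 2 + y ^ 2 = 0 := pow_eq_zero_iff two_ne_zero |>.1 hsq
  exact ⟨eq_zero_of_sq_add_sq_eq_zero hzero, eq_zero_of_sq_add_sq_eq_zero (hnorm ▸ hzero)⟩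

theorem worstCaseGMRES_complex_realStagnationMatrix_lt_one :
    worstCaseGMRES 3 ℂ ℂ realStagnationMatrix < 1 := by
  refine worstCaseGMRES_lt_one (by norm_num) fun b h => ?_
  have h1 := congrArg Complex.re (h 1 (by norm_num) (by norm_num))
  have h1' := congrArg Complex.im (h 1 (by norm_num) (by norm_num))
  have h2 := congrArg Complex.re (h 2 (by norm_num) (by norm_num))
  have h3 := congrArg Complex.re (h 3 (by norm_num) (by norm_num))
  rw [krylovForm, realStagnationMatrix_sq] at h2
  rw [krylovForm, realStagnationMatrix_cube] at h3
  simp [krylovForm, realStagnationMatrix, Fin.sum_univ_four] at h1 h1' h2 h3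
  have hsum : (b 2).re ^ 2 + (b 2).im ^ 2 + ((b 3).re ^ 2 + (b 3).im ^ 2) = 0 := by
    linear_combination h2 / 11
  have h23 := (add_eq_zero_iff_of_nonneg (by positivity) (by positivity)).1 hsum
  obtain ⟨e2, e2'⟩ := eq_zero_of_sq_add_sq_eq_zero h23.1
  obtain ⟨e3, e3'⟩ := eq_zero_of_sq_add_sq_eq_zero h23.2
  rw [e2, e2', e3, e3'] at h1 h1' h3
  have hnorm : (b 0).re ^ 2 + (b 0).im ^ 2 = (b 1).re ^ 2 + (b 1).im ^ 2 := by
    linear_combination h1 / 5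
  -- Only the imaginary part of `b* A b` gives this equation; real polynomials do not detect it.
  have him : (b 0).re * (b 1).im - (b 0).im * (b 1).re = 0 := by linear_combination h1' / 6
  have hre : (b 0).re * (b 1).re + (b 0).im * (b 1).im = 0 := by
    linear_combination -h3 / 192 - 5 / 12 * hnorm
  obtain ⟨h0, h0'⟩ := eq_zero_of_orthogonal_of_parallel hnorm him hre
  ext i
  fin_cases i
  · exact Complex.ext h0.1 h0.2
  · exact Complex.ext h0'.1 h0'.2
  · exact Complex.ext e2 e2'
  · exact Complex.ext e3 e3'

/-- The unit vector `(1, i, 0, 0) / √2`. -/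
noncomputable def stagnationVector : EuclideanSpace ℂ (Fin 4) :=
  WithLp.toLp 2 ![((√2)⁻¹ : ℝ), ((√2)⁻¹ : ℝ) * Complex.I, 0, 0]

theorem norm_stagnationVector : ‖stagnationVector‖ = 1 := by
  rw [EuclideanSpace.norm_eq]
  simp [stagnationVector, Fin.sum_univ_four]
  norm_num

theorem one_le_worstCaseGMRES_complexStagnationMatrix :
    1 ≤ worstCaseGMRES 3 ℂ ℂ complexStagnationMatrix := by
  refine (one_le_gmresResidual norm_stagnationVector fun c j hj hj3 => ?_).trans
    (gmresResidual_le_worstCaseGMRES 3 _ norm_stagnationVector)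
  suffices h : krylovForm complexStagnationMatrix j stagnationVector = 0 by simp [h]
  interval_cases j
  · rw [krylovForm, pow_one]
    apply Complex.ext <;> simp [complexStagnationMatrix, stagnationVector, Fin.sum_univ_four]
  · rw [krylovForm, complexStagnationMatrix_sq]
    apply Complex.ext <;> simp [stagnationVector, Fin.sum_univ_four]
  · rw [krylovForm, complexStagnationMatrix_cube]
    apply Complex.ext <;> simp [stagnationVector, Fin.sum_univ_four]

theorem one_le_worstCaseGMRES_realStagnationMatrix :
    1 ≤ worstCaseGMRES 3 ℝ ℂ realStagnationMatrix := by
  refine (one_le_gmresResidual norm_stagnationVector fun c j hj hj3 => ?_).trans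
    (gmresResidual_le_worstCaseGMRES 3 _ norm_stagnationVector)
  -- The form itself is not zero at `j = 1`: it equals `3i`.
  suffices h : (krylovForm realStagnationMatrix j stagnationVector).re = 0 by simp [h]
  interval_cases j
  · rw [krylovForm, pow_one]
    simp [realStagnationMatrix, stagnationVector, Fin.sum_univ_four]
  · rw [krylovForm, realStagnationMatrix_sq]
    simp [stagnationVector, Fin.sum_univ_four]
  · rw [krylovForm, realStagnationMatrix_cube]
    simp [stagnationVector, Fin.sum_univ_four]

end Examples

theorem theorem6p3 :
    (∀ (n : ℕ) (A : Matrix (Fin n) (Fin n) ℝ) (k : ℕ),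
      A.det ≠ 0 → 1 ≤ k → k ≤ (minpoly ℝ A).natDegree - 1 →
        worstCaseGMRES k ℝ ℝ A = worstCaseGMRES k ℂ ℝ A ∧
        worstCaseGMRES k ℂ ℝ A ≤ worstCaseGMRES k ℂ ℂ A ∧
        worstCaseGMRES k ℂ ℂ A ≤ worstCaseGMRES k ℝ ℂ A) ∧
    (∃ (n : ℕ) (A : Matrix (Fin n) (Fin n) ℝ) (k : ℕ),
      A.det ≠ 0 ∧ 1 ≤ k ∧ k ≤ (minpoly ℝ A).natDegree - 1 ∧
        worstCaseGMRES k ℂ ℝ A < worstCaseGMRES k ℂ ℂ A) ∧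
    (∃ (n : ℕ) (A : Matrix (Fin n) (Fin n) ℝ) (k : ℕ),
      A.det ≠ 0 ∧ 1 ≤ k ∧ k ≤ (minpoly ℝ A).natDegree - 1 ∧
        worstCaseGMRES k ℂ ℂ A < worstCaseGMRES k ℝ ℂ A) := by
  refine ⟨fun n A k _ _ _ => ⟨worstCaseGMRES_real_real_eq k A,
    worstCaseGMRES_complex_real_le k A, worstCaseGMRES_complex_complex_le k A⟩, ?_, ?_⟩
  · exact ⟨4, complexStagnationMatrix, 3, det_complexStagnationMatrix_ne_zero, by norm_num,
      three_le_natDegree_minpoly_complexStagnationMatrix,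
      worstCaseGMRES_real_complexStagnationMatrix_lt_one.trans_le
        one_le_worstCaseGMRES_complexStagnationMatrix⟩
  · exact ⟨4, realStagnationMatrix, 3, det_realStagnationMatrix_ne_zero, by norm_num,
      three_le_natDegree_minpoly_realStagnationMatrix,
      worstCaseGMRES_complex_realStagnationMatrix_lt_one.trans_le
        one_le_worstCaseGMRES_realStagnationMatrix⟩
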